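/- Let $n\ge 1$, let $a_1<a_2<\cdots<a_n$ be integers, let $\chi(x)=\prod_{i=1}^n (x-a_i)$, and let $R=\mathbb{Z}[x]/(\chi(x))$ and $K=\mathbb{Q}\otimes_{\mathbb{Z}}R$. A fractional $R$-ideal is an $R$-submodule of $K$ that is finitely generated of rank $n$ as a $\mathbb{Z}$-module. Two fractional $R$-ideals $I,J$ are equivalent if $I=kJ$ for some $k\in K^\times$. The ideal class group $\mathrm{Cl}(R)$ is the group of units of the monoid of equivalence classes of fractional $R$-ideals under multiplication of ideals. For $S\subseteq\{1,\dots,n\}$ put $\Delta_S=\prod_{i,j\in S,\ i<j}(a_j-a_i)$. For $1\le l\le n-1$ let $\Delta_l$ be the greatest common divisor of the numbers $\Delta_S$, where $S$ runs over all subsets of $\{1,\dots,n\}$ with $l+1$ elements. Let $\Delta=\prod_{1\le i<j\le n}(a_j-a_i)$ (so $\Delta=\Delta_{n-1}$ for $n\ge 2$), and let $\varphi$ be Euler's totient function. If $a_n-a_1\ge 4$, then $$|\mathrm{Cl}(R)|=\frac{\varphi(\Delta)}{2^{n-1}}\prod_{l=1}^{n-2}\frac{\varphi(\Delta_l)}{\Delta_l}.$$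 If $a_n-a_1<4$, then $|\mathrm{Cl}(R)|=1$. -/

import Mathlib

open scoped TensorProduct Polynomial Pointwise

namespace TotallyDegenerate

section IdealClassMonoid

variable (R : Type*) [CommRing R]

/-- The `ℚ`-algebra `K = ℚ ⊗_ℤ R`, in which the fractional ideals of an order `R` live. -/
def RatAlg : Type _ := ℚ ⊗[ℤ] R

noncomputable instance : CommRing (RatAlg R) := inferInstanceAs (CommRing (ℚ ⊗[ℤ] R))

/-- `K` is a `ℚ`-algebra through `q ↦ q ⊗ 1`. -/
noncomputable instance : Algebra ℚ (RatAlg R) := inferInstanceAs (Algebra ℚ (ℚ ⊗[ℤ] R))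

/-- `K` is an `R`-algebra through `r ↦ 1 ⊗ r`. -/
noncomputable instance : Algebra R (RatAlg R) :=
  (Algebra.TensorProduct.includeRight : R →ₐ[ℤ] ℚ ⊗[ℤ] R).toRingHom.toAlgebra

instance [Module.Finite ℤ R] : Module.Finite ℚ (RatAlg R) :=
  inferInstanceAs (Module.Finite ℚ (ℚ ⊗[ℤ] R))

variable {R}

/-- A fractional `R`-ideal: an `R`-submodule of `K = ℚ ⊗_ℤ R` which is finitely generated over `ℤ`
and whose rank over `ℤ` is the dimension of `K` over `ℚ`
(so it is free over `ℤ` of that rank, as `K` is torsion-free). -/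
def IsFracIdeal (I : Submodule R (RatAlg R)) : Prop :=
  Module.Finite ℤ I ∧ Module.finrank ℤ I = Module.finrank ℚ (RatAlg R)

theorem isFracIdeal_iff [Module.Finite ℤ R] (I : Submodule R (RatAlg R)) :
    IsFracIdeal I ↔
      (I.restrictScalars ℤ).FG ∧ Submodule.span ℚ (I : Set (RatAlg R)) = ⊤ := by
  constructor
  · rintro ⟨h1, h2⟩
    have hfg : (I.restrictScalars ℤ).FG := Module.Finite.iff_fg.mp h1
    refine ⟨hfg, ?_⟩
    have h1' : Module.Finite ℤ (I.restrictScalars ℤ) := h1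
    have h2' : Module.finrank ℤ (I.restrictScalars ℤ) = Module.finrank ℚ (RatAlg R) := h2
    have : Submodule.IsLattice ℚ (I.restrictScalars ℤ) := by
      refine Submodule.IsLattice.of_rank_le (K := ℚ) hfg ?_
      rw [← Module.finrank_eq_rank, ← Module.finrank_eq_rank, h2']
    exact this.span_eq_top
  · rintro ⟨h1, h2⟩
    have h : Submodule.IsLattice ℚ (I.restrictScalars ℤ) := ⟨h1, h2⟩
    have h3 := Submodule.IsLattice.rank' ℚ (I.restrictScalars ℤ)
    exact ⟨Module.Finite.iff_fg.mpr h1, congrArg Cardinal.toNat h3⟩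

theorem isFracIdeal_one [Module.Finite ℤ R] : IsFracIdeal (1 : Submodule R (RatAlg R)) := by
  rw [isFracIdeal_iff]
  constructor
  · have h : ((1 : Submodule R (RatAlg R)).restrictScalars ℤ) =
        LinearMap.range ((Algebra.linearMap R (RatAlg R)).restrictScalars ℤ) := by
      ext x
      simp [Submodule.mem_one]
    rw [h]
    exact Module.Finite.iff_fg.mp inferInstance
  · rw [eq_top_iff]
    rintro x -
    induction x using TensorProduct.induction_on with
    | zero => exact zero_mem _
    | add x y hx hy => exact Submodule.add_mem _ hx hy
    | tmul q r =>
      have h : (q ⊗ₜ[ℤ] r : ℚ ⊗[ℤ] R) = q • ((1 : ℚ) ⊗ₜ[ℤ] r) := by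
        simp [TensorProduct.smul_tmul']
      rw [h]
      exact Submodule.smul_mem _ _ (Submodule.subset_span (Submodule.mem_one.mpr ⟨r, rfl⟩))

theorem IsFracIdeal.mul [Module.Finite ℤ R] {I J : Submodule R (RatAlg R)}
    (hI : IsFracIdeal I) (hJ : IsFracIdeal J) : IsFracIdeal (I * J) := by
  rw [isFracIdeal_iff] at *
  constructor
  · have h : (I * J).restrictScalars ℤ = I.restrictScalars ℤ * J.restrictScalars ℤ :=
      Submodule.restrictScalars_mul
    rw [h]
    exact hI.1.mul hJ.1
  · rw [eq_top_iff]
    have h : (⊤ : Submodule ℚ (RatAlg R)) = ⊤ * ⊤ := by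
      apply le_antisymm _ le_top
      intro x _
      rw [← mul_one x]
      exact Submodule.mul_mem_mul trivial trivial
    rw [h]
    nth_rewrite 1 [← hI.2]
    rw [← hJ.2, Submodule.span_mul_span, Submodule.span_le]
    rintro _ ⟨i, hi, j, hj, rfl⟩
    exact Submodule.subset_span (Submodule.mul_mem_mul hi hj)

variable (R) [Module.Finite ℤ R]

/-- The multiplicative monoid of fractional `R`-ideals in `K`; the product is the product of
submodules of the algebra `K`. -/
def fracIdeals : Submonoid (Submodule R (RatAlg R)) where
  carrier := {I | IsFracIdeal I}
  one_mem' := isFracIdeal_one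
  mul_mem' := IsFracIdeal.mul

/-- Linear equivalence of fractional ideals: `I ∼ J` if `I = k J` for a unit `k` of `K`. -/
def linearEquiv : Con (fracIdeals R) where
  r I J := ∃ k : (RatAlg R)ˣ,
    (I : Submodule R (RatAlg R)) = (k : RatAlg R) • (J : Submodule R (RatAlg R))
  iseqv := by
    refine ⟨fun I => ⟨1, by simp⟩, ?_, ?_⟩
    · rintro I J ⟨k, hk⟩
      exact ⟨k⁻¹, by rw [hk, smul_smul]; simp⟩
    · rintro I J L ⟨k, hk⟩ ⟨l, hl⟩
      exact ⟨k * l, by rw [hk, hl, smul_smul]; simp⟩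
  mul' := by
    rintro I J L M ⟨k, hk⟩ ⟨l, hl⟩
    refine ⟨k * l, ?_⟩
    simp only [Submonoid.coe_mul, Units.val_mul, hk, hl, ← Submodule.span_singleton_mul]
    rw [mul_mul_mul_comm, Submodule.span_mul_span, Set.singleton_mul_singleton]

/-- The ideal class monoid: fractional `R`-ideals up to linear equivalence. -/
abbrev ICM : Type _ := (linearEquiv R).Quotient

/-- The ideal class group: the group of units of the ideal class monoid. -/
abbrev Cl : Type _ := (ICM R)ˣ

end IdealClassMonoid

/-- The polynomial `χ(x) = ∏ (x - a_i)`. -/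
noncomputable abbrev chi {n : ℕ} (a : Fin n → ℤ) : ℤ[X] :=
  ∏ i, (Polynomial.X - Polynomial.C (a i))

/-- The ring `R = ℤ[x]/(χ(x))`. -/
abbrev ring {n : ℕ} (a : Fin n → ℤ) : Type := AdjoinRoot (chi a)

instance ring_finite {n : ℕ} (a : Fin n → ℤ) : Module.Finite ℤ (ring a) :=
  (Polynomial.monic_prod_X_sub_C a Finset.univ).finite_adjoinRoot

/-- `Δ_S = ∏_{i < j in S} (a_j - a_i)`. -/
def partialVandermonde {n : ℕ} (a : Fin n → ℤ) (S : Finset (Fin n)) : ℤ :=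
  ∏ p ∈ S ×ˢ S with p.1 < p.2, (a p.2 - a p.1)

/-- `Δ_k`, the (nonnegative) gcd of the `Δ_S` over all `S` with `k + 1` elements. -/
def vandermondeGcd {n : ℕ} (a : Fin n → ℤ) (k : ℕ) : ℕ :=
  (Finset.univ.powersetCard (k + 1)).gcd fun S => (partialVandermonde a S).natAbs

end TotallyDegenerate

namespace TotallyDegenerate
open Polynomial

variable {n : ℕ} {a : Fin n → ℤ}

/-! Since the roots are distinct, evaluation identifies `K` with ℚⁿ and `R` with the tuples (f(a_1),
…, f(a_n)). Fix m ≥ 4 with mℤⁿ ⊆ R and put G = ((ℤ/m)ˣ)ⁿ. Every invertible ideal class contains some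
uR + mℤⁿ with u ∈ G (`classHom_surjective`), and this ideal is principal exactly when u is a sign
tuple times a tuple of polynomial values (`ker_classHom`). Hence Cl(R) ≅ G/(SP), with S the sign
tuples and P the polynomial tuples.

The index of P comes from Newton interpolation: the obstruction to extending a polynomial tuple to
one more point a_k is an arbitrary unit modulo N_k = ∏_{i<k} (a_k - a_i), so [G : P] = ∏ φ(N_k)
(`index_polyUnits`). If the spread is at least 4, then S ∩ P = {1, -1} (`sign_values_const`) and
|Cl(R)| = 2 ∏ φ(N_k) / 2ⁿ. If it is smaller, every N_k divides 6, every obstruction is a sign, and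
SP = G.

It remains to pass from the N_k to the Δ_l. Their products over k and over l differ in general, but
for each prime p as many N_k as Δ_l are divisible by p, so the products of φ(N)/N agree
(`prod_totient_lowerProd`); moreover ∏ N_k = Δ. -/

/-! ### The modulus and integral interpolation. -/

/-- The product of all the differences `a i - a j` with `i ≠ j`. -/
def diffProd (a : Fin n → ℤ) : ℤ := ∏ i, ∏ j ∈ Finset.univ.erase i, (a i - a j)

/-- A modulus `m` such that `m ℤⁿ ⊆ ℤ[x]/(χ)` inside `ℤⁿ`. -/
def modulus (a : Fin n → ℤ) : ℕ := 4 * (diffProd a).natAbs ^ 2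

theorem modulus_cast (a : Fin n → ℤ) : (modulus a : ℤ) = 4 * diffProd a ^ 2 := by
  simp [modulus]

theorem diffProd_ne_zero (ha : Function.Injective a) : diffProd a ≠ 0 := by
  refine Finset.prod_ne_zero_iff.mpr fun i _ => Finset.prod_ne_zero_iff.mpr fun j hj => ?_
  rw [Finset.mem_erase] at hj
  exact sub_ne_zero.mpr fun h => hj.1 (ha h).symm

theorem modulus_ne_zero (ha : Function.Injective a) : modulus a ≠ 0 := by
  have := diffProd_ne_zero ha
  simp [modulus, this]

/-- The factor 4 in `modulus` keeps 1 and -1 distinct modulo m even if all differences are units. -/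
theorem four_le_modulus (ha : Function.Injective a) : 4 ≤ modulus a := by
  have : 0 < (diffProd a).natAbs ^ 2 := by
    have := diffProd_ne_zero ha
    positivity
  unfold modulus
  omega

theorem prod_sub_dvd_diffProd (i : Fin n) (s : Finset (Fin n)) (hs : i ∉ s) :
    ∏ j ∈ s, (a i - a j) ∣ diffProd a := by
  refine dvd_trans (Finset.prod_dvd_prod_of_subset _ (Finset.univ.erase i) _ ?_)
    (Finset.dvd_prod_of_mem (fun i => ∏ j ∈ Finset.univ.erase i, (a i - a j)) (Finset.mem_univ i))
  intro j hj
  exact Finset.mem_erase.mpr ⟨fun h => hs (h ▸ hj), Finset.mem_univ j⟩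

theorem diffProd_dvd_modulus (a : Fin n → ℤ) : diffProd a ∣ (modulus a : ℤ) := by
  rw [modulus_cast]
  exact Dvd.intro_left (4 * diffProd a) (by ring)

/-- Multiples of `diffProd a` can be interpolated by integral polynomials. -/
theorem exists_interpolation (v : Fin n → ℤ) :
    ∃ g : ℤ[X], ∀ i, g.eval (a i) = diffProd a * v i := by
  have h : ∀ i, ∃ c : ℤ, diffProd a = (∏ j ∈ Finset.univ.erase i, (a i - a j)) * c := fun i =>
    prod_sub_dvd_diffProd i _ (Finset.notMem_erase i _)
  choose c hc using h
  -- Lagrange interpolation; `c i` is `diffProd a` divided by the i-th Lagrange denominator.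
  refine ⟨∑ i, C (c i * v i) * ∏ j ∈ Finset.univ.erase i, (X - C (a j)), fun k => ?_⟩
  rw [eval_finsetSum, Finset.sum_eq_single k]
  · simp only [eval_mul, eval_C, eval_prod, eval_sub, eval_X]
    conv_rhs => rw [hc k]
    ring
  · intro i _ hik
    rw [eval_mul, eval_prod, Finset.prod_eq_zero (i := k), mul_zero]
    · exact Finset.mem_erase.mpr ⟨hik.symm, Finset.mem_univ k⟩
    · simp
  · simp

theorem exists_interpolation_modulus (v : Fin n → ℤ) :
    ∃ g : ℤ[X], ∀ i, g.eval (a i) = modulus a * v i := by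
  obtain ⟨g, hg⟩ := exists_interpolation (a := a) fun i => 4 * diffProd a * v i
  exact ⟨g, fun i => by rw [hg, modulus_cast]; ring⟩

theorem prod_X_sub_C_dvd_of_eval_eq_zero (ha : Function.Injective a) (s : Finset (Fin n))
    (f : ℤ[X]) (hf : ∀ i ∈ s, f.eval (a i) = 0) : ∏ i ∈ s, (X - C (a i)) ∣ f := by
  rcases eq_or_ne f 0 with rfl | h0
  · exact dvd_zero _
  have h := (Multiset.prod_X_sub_C_dvd_iff_le_roots h0 (s.val.map a)).mpr ?_
  · rw [Multiset.map_map] at h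
    exact h
  · rw [Multiset.le_iff_subset (s.nodup.map ha)]
    intro x hx
    obtain ⟨i, hi, rfl⟩ := Multiset.mem_map.mp hx
    exact (mem_roots h0).mpr (hf i hi)

/-- If `f` vanishes modulo `modulus a` at the `a i` with `i ∈ s`, then `f (a k)` is divisible by
`∏ i ∈ s, (a k - a i)`. -/
theorem prod_sub_dvd_eval (ha : Function.Injective a) (s : Finset (Fin n)) (k : Fin n)
    (hk : k ∉ s) (f : ℤ[X]) (hf : ∀ i ∈ s, (modulus a : ℤ) ∣ f.eval (a i)) :
    ∏ i ∈ s, (a k - a i) ∣ f.eval (a k) := by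
  have h : ∀ i, ∃ w : ℤ, i ∈ s → f.eval (a i) = modulus a * w := fun i => by
    by_cases hi : i ∈ s
    · obtain ⟨w, hw⟩ := hf i hi
      exact ⟨w, fun _ => hw⟩
    · exact ⟨0, fun h => absurd h hi⟩
  choose w hw using h
  obtain ⟨g, hg⟩ := exists_interpolation (a := a) w
  -- This is why the modulus contains a square: one factor `diffProd a` interpolates the quotients
  -- `w`, the other makes the correction at `a k` divisible by the product.
  have h1 : ∏ i ∈ s, (X - C (a i)) ∣ f - C (4 * diffProd a) * g := by
    refine prod_X_sub_C_dvd_of_eval_eq_zero ha s _ fun i hi => ?_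
    rw [eval_sub, hw i hi, eval_mul, eval_C, hg, modulus_cast]
    ring
  have h2 : ∏ i ∈ s, (a k - a i) ∣ f.eval (a k) - 4 * diffProd a * g.eval (a k) := by
    have := eval_dvd (x := a k) h1
    simpa [eval_prod] using this
  have h3 : ∏ i ∈ s, (a k - a i) ∣ 4 * diffProd a * g.eval (a k) :=
    dvd_mul_of_dvd_left (dvd_mul_of_dvd_right (prod_sub_dvd_diffProd k s hk) 4) _
  simpa using dvd_add h2 h3

/-! ### Coordinates on `K`. -/

/-- Evaluation of polynomial classes at the points `a i`. -/
noncomputable def evalHom (a : Fin n → ℤ) : ring a →ₐ[ℤ] (Fin n → ℚ) :=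
  AdjoinRoot.liftAlgHom (chi a) (Algebra.ofId ℤ _) (fun i => (a i : ℚ)) (by
    change aeval (fun i => (a i : ℚ)) (chi a) = 0
    ext j
    rw [map_prod, Finset.prod_apply]
    exact Finset.prod_eq_zero (Finset.mem_univ j) (by simp))

theorem evalHom_mk (f : ℤ[X]) (i : Fin n) :
    evalHom a (AdjoinRoot.mk (chi a) f) i = (f.eval (a i) : ℤ) := by
  have h : ((Pi.evalRingHom (fun _ : Fin n => ℚ) i).comp
      ((evalHom a).toRingHom.comp (AdjoinRoot.mk (chi a)))) =
      (Int.castRingHom ℚ).comp (evalRingHom (a i)) := by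
    ext <;> simp [evalHom]
  exact RingHom.congr_fun h f

/-- The coordinates of `ℚ ⊗ ℤ[x]/(χ)` at the zeros of `χ`. -/
noncomputable def coordsHom (a : Fin n → ℤ) : RatAlg (ring a) →ₐ[ℚ] (Fin n → ℚ) :=
  (Algebra.TensorProduct.lift (Algebra.ofId ℚ (Fin n → ℚ)) (evalHom a)
    (fun _ _ => Commute.all _ _) : ℚ ⊗[ℤ] ring a →ₐ[ℚ] (Fin n → ℚ))

theorem coordsHom_algebraMap (r : ring a) :
    coordsHom a (algebraMap (ring a) (RatAlg (ring a)) r) = evalHom a r := by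
  have : coordsHom a (algebraMap (ring a) (RatAlg (ring a)) r) =
    Algebra.TensorProduct.lift (Algebra.ofId ℚ (Fin n → ℚ)) (evalHom a)
    (fun _ _ => Commute.all _ _) (1 ⊗ₜ r) := rfl
  rw [this, Algebra.TensorProduct.lift_tmul]
  simp

/-- Interpolants divided by `diffProd a` hit the standard basis; injectivity follows because both
sides have dimension n. -/
theorem coordsHom_bijective (ha : Function.Injective a) : Function.Bijective (coordsHom a) := by
  have hsurj : Function.Surjective (coordsHom a) := by
    intro y
    obtain ⟨g, hg⟩ : ∃ g : Fin n → ℤ[X], ∀ j i, (g j).eval (a i) =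
        diffProd a * (Pi.single j 1 : Fin n → ℤ) i :=
      ⟨fun j => (exists_interpolation (Pi.single j 1)).choose,
        fun j => (exists_interpolation (Pi.single j 1)).choose_spec⟩
    refine ⟨∑ j, (y j / diffProd a) • algebraMap (ring a) (RatAlg (ring a))
      (AdjoinRoot.mk (chi a) (g j)), ?_⟩
    ext i
    have h0 : (diffProd a : ℚ) ≠ 0 := by exact_mod_cast diffProd_ne_zero ha
    simp only [map_sum, map_smul, coordsHom_algebraMap, Finset.sum_apply, Pi.smul_apply,
      evalHom_mk, hg]
    rw [Finset.sum_eq_single i]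
    · simp [h0]
    · intro j _ hj
      simp [hj.symm]
    · simp
  have hrank : Module.finrank ℚ (RatAlg (ring a)) = Module.finrank ℚ (Fin n → ℚ) := by
    have hm : (chi a).Monic := monic_prod_X_sub_C a Finset.univ
    have : Module.Free ℤ (ring a) := Module.Free.of_basis (AdjoinRoot.powerBasis' hm).basis
    have h1 : Module.finrank ℚ (RatAlg (ring a)) = Module.finrank ℤ (ring a) :=
      Module.finrank_baseChange
    rw [h1, (AdjoinRoot.powerBasis' hm).finrank, AdjoinRoot.powerBasis'_dim]
    simp [natDegree_finsetProd_X_sub_C_eq_card]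
  exact ⟨(LinearMap.injective_iff_surjective_of_finrank_eq_finrank
    (f := (coordsHom a).toLinearMap) hrank).mpr hsurj, hsurj⟩

/-- The isomorphism of `ℚ ⊗ ℤ[x]/(χ)` with `ℚⁿ`. -/
noncomputable def coords (ha : Function.Injective a) : RatAlg (ring a) ≃ₐ[ℚ] (Fin n → ℚ) :=
  AlgEquiv.ofBijective (coordsHom a) (coordsHom_bijective ha)

theorem coords_algebraMap_mk (ha : Function.Injective a) (f : ℤ[X]) (i : Fin n) :
    coords ha (algebraMap (ring a) (RatAlg (ring a)) (AdjoinRoot.mk (chi a) f)) i =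
      (f.eval (a i) : ℤ) := by
  rw [← evalHom_mk, ← coordsHom_algebraMap]
  rfl

theorem coords_smul (ha : Function.Injective a) (f : ℤ[X]) (x : RatAlg (ring a)) (i : Fin n) :
    coords ha (AdjoinRoot.mk (chi a) f • x) i = (f.eval (a i) : ℤ) * coords ha x i := by
  rw [Algebra.smul_def, map_mul, Pi.mul_apply, coords_algebraMap_mk]

theorem mem_one_iff_coords (ha : Function.Injective a) (x : RatAlg (ring a)) :
    x ∈ (1 : Submodule (ring a) (RatAlg (ring a))) ↔
      ∃ f : ℤ[X], ∀ i, coords ha x i = (f.eval (a i) : ℤ) := by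
  rw [Submodule.mem_one]
  constructor
  · rintro ⟨r, rfl⟩
    obtain ⟨f, rfl⟩ := AdjoinRoot.mk_surjective r
    exact ⟨f, coords_algebraMap_mk ha f⟩
  · rintro ⟨f, hf⟩
    refine ⟨AdjoinRoot.mk (chi a) f, (coords ha).injective ?_⟩
    ext i
    rw [hf, coords_algebraMap_mk]

/-! ### The ideals uR + mℤⁿ and their classes. -/

/-- The fractional ideal `u R + m ℤⁿ` attached to a tuple `u` of units modulo `m`. -/
noncomputable def unitIdeal (ha : Function.Injective a) (u : Fin n → (ZMod (modulus a))ˣ) :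
    Submodule (ring a) (RatAlg (ring a)) where
  carrier := {x | ∃ z : Fin n → ℤ, (∀ i, coords ha x i = z i) ∧
    ∃ f : ℤ[X], ∀ i, (z i : ZMod (modulus a)) = u i * (f.eval (a i) : ℤ)}
  add_mem' := by
    rintro x y ⟨z, hz, f, hf⟩ ⟨w, hw, g, hg⟩
    exact ⟨z + w, fun i => by simp [hz, hw], f + g, fun i => by simp [hf, hg, mul_add]⟩
  zero_mem' := ⟨0, fun i => by simp, 0, fun i => by simp⟩
  smul_mem' := by
    rintro r x ⟨z, hz, f, hf⟩
    obtain ⟨g, rfl⟩ := AdjoinRoot.mk_surjective r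
    refine ⟨fun i => g.eval (a i) * z i, fun i => by simp [coords_smul, hz], g * f, fun i => ?_⟩
    push_cast [hf, eval_mul]
    ring

theorem mem_unitIdeal {ha : Function.Injective a} {u : Fin n → (ZMod (modulus a))ˣ}
    {x : RatAlg (ring a)} :
    x ∈ unitIdeal ha u ↔ ∃ z : Fin n → ℤ, (∀ i, coords ha x i = z i) ∧
      ∃ f : ℤ[X], ∀ i, (z i : ZMod (modulus a)) = u i * (f.eval (a i) : ℤ) :=
  Iff.rfl

/-- The element of `ℚ ⊗ ℤ[x]/(χ)` with given integral coordinates. -/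
noncomputable def ofInt (ha : Function.Injective a) (z : Fin n → ℤ) : RatAlg (ring a) :=
  (coords ha).symm fun i => (z i : ℚ)

theorem coords_ofInt (ha : Function.Injective a) (z : Fin n → ℤ) (i : Fin n) :
    coords ha (ofInt ha z) i = z i := by
  simp [ofInt]

theorem eq_ofInt {ha : Function.Injective a} {x : RatAlg (ring a)} {z : Fin n → ℤ}
    (h : ∀ i, coords ha x i = z i) : x = ofInt ha z :=
  (coords ha).injective (by ext i; rw [h, coords_ofInt])

theorem ofInt_mul (ha : Function.Injective a) (z w : Fin n → ℤ) :
    ofInt ha (z * w) = ofInt ha z * ofInt ha w :=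
  (eq_ofInt fun i => by simp [coords_ofInt]).symm

theorem ofInt_add (ha : Function.Injective a) (z w : Fin n → ℤ) :
    ofInt ha (z + w) = ofInt ha z + ofInt ha w :=
  (eq_ofInt fun i => by simp [coords_ofInt]).symm

theorem ofInt_mem_unitIdeal {ha : Function.Injective a} {u : Fin n → (ZMod (modulus a))ˣ}
    {z : Fin n → ℤ} :
    ofInt ha z ∈ unitIdeal ha u ↔
      ∃ f : ℤ[X], ∀ i, (z i : ZMod (modulus a)) = u i * (f.eval (a i) : ℤ) := by
  constructor
  · rintro ⟨w, hw, h⟩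
    have : z = w := by
      ext i
      have := hw i
      rw [coords_ofInt] at this
      exact_mod_cast this
    rwa [this]
  · exact fun h => ⟨z, coords_ofInt ha z, h⟩

theorem unitIdeal_mul (ha : Function.Injective a) (u v : Fin n → (ZMod (modulus a))ˣ) :
    unitIdeal ha u * unitIdeal ha v = unitIdeal ha (u * v) := by
  apply le_antisymm
  · rw [Submodule.mul_le]
    rintro x ⟨z, hz, f, hf⟩ y ⟨w, hw, g, hg⟩
    refine ⟨z * w, fun i => by simp [hz, hw], f * g, fun i => ?_⟩
    simp only [Pi.mul_apply, Int.cast_mul, hf, hg, eval_mul, Units.val_mul]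
    ring
  · rintro x ⟨z, hz, f, hf⟩
    rw [eq_ofInt hz]
    choose U hU using fun i => ZMod.intCast_surjective (u i : ZMod (modulus a))
    choose V hV using fun i => ZMod.intCast_surjective (v i : ZMod (modulus a))
    choose P hP using fun i => ZMod.intCast_surjective ((u i)⁻¹ : (ZMod (modulus a))ˣ).val
    have h1 : ∀ i, ∃ q, U i * P i = 1 + modulus a * q := fun i => by
      have : ((U i * P i - 1 : ℤ) : ZMod (modulus a)) = 0 := by simp [hU, hP]
      obtain ⟨q, hq⟩ := (ZMod.intCast_zmod_eq_zero_iff_dvd _ _).mp this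
      exact ⟨q, by rw [← hq]; ring⟩
    choose q hq using h1
    have h2 : ∀ i, ∃ w, z i = U i * f.eval (a i) * V i + modulus a * w := fun i => by
      have : ((z i - U i * f.eval (a i) * V i : ℤ) : ZMod (modulus a)) = 0 := by
        push_cast [hU, hV, hf, Pi.mul_apply, Units.val_mul]
        ring
      obtain ⟨q, hq⟩ := (ZMod.intCast_zmod_eq_zero_iff_dvd _ _).mp this
      exact ⟨q, by rw [← hq]; ring⟩
    choose w hw using h2
    -- With UP = 1 + mq one has mw = U·(mPw) + (-mq)·(mw), which writes z as a sum of three products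
    -- of an element of the first ideal and one of the second.
    have key : z = ((fun i => U i * f.eval (a i)) * V + U * (fun i => modulus a * (P i * w i))) +
        (fun i => modulus a * (- q i)) * (fun i => modulus a * w i) := by
      ext i
      simp only [Pi.add_apply, Pi.mul_apply]
      linear_combination hw i - modulus a * w i * hq i
    rw [key, ofInt_add, ofInt_add, ofInt_mul, ofInt_mul, ofInt_mul]
    refine add_mem (add_mem ?_ ?_) ?_ <;> refine Submodule.mul_mem_mul ?_ ?_ <;>
      rw [ofInt_mem_unitIdeal]
    · exact ⟨f, fun i => by simp [hU]⟩
    · exact ⟨1, fun i => by simp [hV]⟩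
    · exact ⟨1, fun i => by simp [hU]⟩
    · exact ⟨0, fun i => by simp⟩
    · exact ⟨0, fun i => by simp⟩
    · exact ⟨0, fun i => by simp⟩

theorem unitIdeal_one (ha : Function.Injective a) : unitIdeal ha 1 = 1 := by
  ext x
  rw [mem_one_iff_coords ha, mem_unitIdeal]
  constructor
  · rintro ⟨z, hz, f, hf⟩
    have h2 : ∀ i, ∃ w, z i = f.eval (a i) + modulus a * w := fun i => by
      have : ((z i - f.eval (a i) : ℤ) : ZMod (modulus a)) = 0 := by
        push_cast [hf]
        simp
      obtain ⟨q, hq⟩ := (ZMod.intCast_zmod_eq_zero_iff_dvd _ _).mp this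
      exact ⟨q, by rw [← hq]; ring⟩
    choose w hw using h2
    obtain ⟨g, hg⟩ := exists_interpolation_modulus (a := a) w
    exact ⟨f + g, fun i => by rw [hz, hw, eval_add, hg]⟩
  · rintro ⟨f, hf⟩
    exact ⟨_, hf, f, fun i => by simp⟩

/-- The ideal lies between mℤⁿ and ℤⁿ. -/
theorem isFracIdeal_unitIdeal (ha : Function.Injective a) (u : Fin n → (ZMod (modulus a))ˣ) :
    IsFracIdeal (unitIdeal ha u) := by
  rw [isFracIdeal_iff]
  constructor
  · let φ : (Fin n → ℤ) →ₗ[ℤ] RatAlg (ring a) :=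
      (AddMonoidHom.mk' (ofInt ha) (ofInt_add ha)).toIntLinearMap
    have hle : (unitIdeal ha u).restrictScalars ℤ ≤ LinearMap.range φ := by
      rintro x ⟨z, hz, -⟩
      exact ⟨z, (eq_ofInt hz).symm⟩
    have : IsNoetherian ℤ (LinearMap.range φ) := isNoetherian_of_fg_of_noetherian _
      (Module.Finite.iff_fg.mp inferInstance)
    exact Submodule.FG.of_le (Module.Finite.iff_fg.mp inferInstance) hle
  · rw [eq_top_iff]
    rintro x -
    have h0 : (modulus a : ℚ) ≠ 0 := by exact_mod_cast modulus_ne_zero ha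
    have : x = ∑ i, (coords ha x i / modulus a) • ofInt ha (Pi.single i (modulus a : ℤ)) := by
      apply (coords ha).injective
      ext j
      simp only [map_sum, map_smul, Finset.sum_apply, Pi.smul_apply, coords_ofInt]
      rw [Finset.sum_eq_single j]
      · simp [h0]
      · intro i _ hij
        simp [hij.symm]
      · simp
    rw [this]
    refine Submodule.sum_mem _ fun i _ => Submodule.smul_mem _ _ (Submodule.subset_span ?_)
    refine ofInt_mem_unitIdeal.mpr ⟨0, fun j => ?_⟩
    rcases eq_or_ne j i with rfl | h
    · simp
    · simp [h]

/-- The homomorphism to the ideal class monoid sending `u` to the class of `u R + m ℤⁿ`. -/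
noncomputable def classMonoidHom (ha : Function.Injective a) :
    (Fin n → (ZMod (modulus a))ˣ) →* ICM (ring a) where
  toFun u := ((⟨unitIdeal ha u, isFracIdeal_unitIdeal ha u⟩ : fracIdeals (ring a)) : ICM (ring a))
  map_one' := congrArg _ (Subtype.ext (unitIdeal_one ha))
  map_mul' u v := by
    rw [← Con.coe_mul]
    exact congrArg _ (Subtype.ext (unitIdeal_mul ha u v).symm)

/-- The homomorphism to the ideal class group sending `u` to the class of `u R + m ℤⁿ`. -/
noncomputable def classHom (ha : Function.Injective a) :
    (Fin n → (ZMod (modulus a))ˣ) →* Cl (ring a) :=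
  (classMonoidHom ha).toHomUnits

theorem mem_ker_classHom_iff (ha : Function.Injective a) (u : Fin n → (ZMod (modulus a))ˣ) :
    u ∈ (classHom ha).ker ↔ ∃ k : (RatAlg (ring a))ˣ,
      unitIdeal ha u = (k : RatAlg (ring a)) • (1 : Submodule (ring a) (RatAlg (ring a))) := by
  rw [MonoidHom.mem_ker, Units.ext_iff]
  exact Con.eq _

/-! ### The kernel of the class homomorphism. -/

/-- The tuples of signs, as a subgroup of the tuples of units modulo `m`. -/
def signs (a : Fin n → ℤ) : Subgroup (Fin n → (ZMod (modulus a))ˣ) where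
  carrier := {u | ∀ i, u i = 1 ∨ u i = -1}
  mul_mem' := by
    intro u v hu hv i
    rcases hu i with h | h <;> rcases hv i with h' | h' <;> simp [h, h']
  one_mem' := fun i => Or.inl rfl
  inv_mem' := by
    intro u hu i
    rcases hu i with h | h <;> simp [h]

/-- The tuples of units modulo `m` whose first `k` entries are the values of a polynomial. -/
def polyUnits (a : Fin n → ℤ) (k : ℕ) : Subgroup (Fin n → (ZMod (modulus a))ˣ) where
  carrier := {u | ∃ f : ℤ[X], ∀ i : Fin n, (i : ℕ) < k →
    ((u i : (ZMod (modulus a))ˣ) : ZMod (modulus a)) = (f.eval (a i) : ℤ)}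
  mul_mem' := by
    rintro u v ⟨f, hf⟩ ⟨g, hg⟩
    exact ⟨f * g, fun i hi => by simp [hf i hi, hg i hi]⟩
  one_mem' := ⟨1, by simp⟩
  inv_mem' := by
    rintro u ⟨f, hf⟩
    -- In a finite group the inverse is a positive or zero power, so it is again given by a
    -- polynomial.
    refine ⟨f ^ (Nat.card (ZMod (modulus a))ˣ - 1), fun i hi => ?_⟩
    have hfin : Finite (ZMod (modulus a))ˣ := by
      -- Injectivity of `a` is not assumed here, so the modulus may be 0; the unit group is then
      -- that of ℤ, still finite.
      rcases Nat.eq_zero_or_pos (modulus a) with h | h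
      · rw [h]
        exact inferInstanceAs (Finite ℤˣ)
      · have : NeZero (modulus a) := ⟨h.ne'⟩
        infer_instance
    have h1 : (u i)⁻¹ = u i ^ (Nat.card (ZMod (modulus a))ˣ - 1) := by
      rw [inv_eq_iff_mul_eq_one, ← pow_succ', Nat.sub_add_cancel Nat.card_pos, pow_card_eq_one']
    rw [Pi.inv_apply, h1, Units.val_pow_eq_pow_val, hf i hi, eval_pow, Int.cast_pow]

theorem exists_sign_of_mem_signs {u : Fin n → (ZMod (modulus a))ˣ} (hu : u ∈ signs a) :
    ∃ s : Fin n → ℤ, s * s = 1 ∧ ∀ i, (s i : ZMod (modulus a)) = u i := by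
  have : ∀ i, ∃ s : ℤ, s * s = 1 ∧ (s : ZMod (modulus a)) = u i := fun i => by
    rcases hu i with h | h
    · exact ⟨1, by simp [h]⟩
    · exact ⟨-1, by simp [h]⟩
  choose s hs using this
  exact ⟨s, funext fun i => (hs i).1, fun i => (hs i).2⟩

theorem ofInt_zero (ha : Function.Injective a) : ofInt ha 0 = 0 :=
  (eq_ofInt fun i => by simp).symm

theorem ofInt_one (ha : Function.Injective a) : ofInt ha 1 = 1 :=
  (eq_ofInt fun i => by simp).symm

/-- A sign tuple lifts to an integral s with s² = 1, and the ideal is sR. -/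
theorem signs_le_ker (ha : Function.Injective a) : signs a ≤ (classHom ha).ker := by
  intro u hu
  obtain ⟨s, hs, hsu⟩ := exists_sign_of_mem_signs hu
  have hss : ofInt ha s * ofInt ha s = 1 := by rw [← ofInt_mul, hs, ofInt_one]
  rw [mem_ker_classHom_iff, ← unitIdeal_one ha]
  have hinv : ∀ i, ((u i : (ZMod (modulus a))ˣ) : ZMod (modulus a)) * u i = 1 := fun i => by
    rw [← hsu, ← Int.cast_mul, ← Pi.mul_apply s s, hs]
    simp
  refine ⟨⟨ofInt ha s, ofInt ha s, hss, hss⟩, le_antisymm ?_ ?_⟩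
  · rintro x ⟨z, hz, f, hf⟩
    rw [Submodule.mem_smul_pointwise_iff_exists]
    refine ⟨ofInt ha (s * z), ofInt_mem_unitIdeal.mpr ⟨f, fun i => ?_⟩, ?_⟩
    · simp only [Pi.mul_apply, Int.cast_mul, hsu, hf, ← mul_assoc, hinv]
      simp
    · rw [eq_ofInt hz, smul_eq_mul, ← ofInt_mul, ← mul_assoc, hs, one_mul]
  · intro x hx
    rw [Submodule.mem_smul_pointwise_iff_exists] at hx
    obtain ⟨y, ⟨z, hz, f, hf⟩, rfl⟩ := hx
    rw [eq_ofInt hz, smul_eq_mul, ← ofInt_mul]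
    refine ofInt_mem_unitIdeal.mpr ⟨f, fun i => ?_⟩
    simp [hsu, hf]

theorem polyUnits_le_ker (ha : Function.Injective a) : polyUnits a n ≤ (classHom ha).ker := by
  intro u hu
  rw [mem_ker_classHom_iff, ← unitIdeal_one ha]
  obtain ⟨g, hg⟩ := hu
  obtain ⟨h, hh⟩ := (polyUnits a n).inv_mem ⟨g, hg⟩
  refine ⟨1, ?_⟩
  rw [Units.val_one, one_smul]
  refine le_antisymm ?_ ?_
  · rintro x ⟨z, hz, f, hf⟩
    exact ⟨z, hz, g * f, fun i => by rw [hf, hg i i.2]; simp⟩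
  · rintro x ⟨z, hz, f, hf⟩
    refine ⟨z, hz, h * f, fun i => ?_⟩
    rw [hf, eval_mul, Int.cast_mul, ← hh i i.2]
    simp

/-- If uR + mℤⁿ = kR, then k has integral coordinates z, and each z_i divides the i-th coordinate of
every element, in particular a lift of u_i and m. These are coprime, so z is a sign tuple; as k lies
in the ideal, z is u times polynomial values modulo m. -/
theorem ker_classHom (ha : Function.Injective a) :
    (classHom ha).ker = signs a ⊔ polyUnits a n := by
  refine le_antisymm ?_ (sup_le (signs_le_ker ha) (polyUnits_le_ker ha))
  intro u hu
  obtain ⟨k, hk⟩ := (mem_ker_classHom_iff ha u).mp hu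
  have h1 : (k : RatAlg (ring a)) ∈ unitIdeal ha u := by
    rw [hk, Submodule.mem_smul_pointwise_iff_exists]
    exact ⟨1, (Submodule.one_le.mp le_rfl), by simp⟩
  obtain ⟨z, hz, f, hf⟩ := h1
  have hdvd : ∀ y : Fin n → ℤ, ofInt ha y ∈ unitIdeal ha u → ∀ i, z i ∣ y i := by
    intro y hy i
    rw [hk, Submodule.mem_smul_pointwise_iff_exists] at hy
    obtain ⟨r, hr, hry⟩ := hy
    obtain ⟨g, hg⟩ := (mem_one_iff_coords ha r).mp hr
    have h2 : coords ha ((k : RatAlg (ring a)) • r) i = y i := by rw [hry, coords_ofInt]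
    rw [smul_eq_mul, map_mul, Pi.mul_apply, hz, hg] at h2
    exact ⟨g.eval (a i), by exact_mod_cast h2.symm⟩
  choose U hU using fun i => ZMod.intCast_surjective (u i : ZMod (modulus a))
  have hzunit : ∀ i, IsUnit (z i) := by
    intro i
    have h2 : IsCoprime (U i) (modulus a : ℤ) := by
      rw [isCoprime_comm, ← ZMod.coe_int_isUnit_iff_isCoprime, hU]
      exact (u i).isUnit
    have h3 := hdvd U (ofInt_mem_unitIdeal.mpr ⟨1, by simp [hU]⟩) i
    have h4 := hdvd (fun _ => modulus a) (ofInt_mem_unitIdeal.mpr ⟨0, by simp⟩) i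
    exact h2.isUnit_of_dvd' h3 h4
  let ε : Fin n → (ZMod (modulus a))ˣ := fun i =>
    Units.map (Int.castRingHom (ZMod (modulus a))).toMonoidHom (hzunit i).unit
  have hε : ∀ i, ((ε i : (ZMod (modulus a))ˣ) : ZMod (modulus a)) = z i := fun i => rfl
  have hε' : ε ∈ signs a := fun i => by
    rcases Int.isUnit_iff.mp (hzunit i) with h | h
    · left
      ext
      simp [hε, h]
    · right
      ext
      simp [hε, h]
  have hw : u⁻¹ * ε ∈ polyUnits a n := ⟨f, fun i _ => by simp [hε, hf]⟩
  have : u = ε * (u⁻¹ * ε)⁻¹ := by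
    rw [mul_inv_rev, inv_inv, mul_inv_cancel_left]
  rw [this]
  exact Subgroup.mul_mem_sup hε' (inv_mem hw)

/-! ### Surjectivity -/

theorem ofInt_sum_mem (ha : Function.Injective a) {I : Submodule (ring a) (RatAlg (ring a))}
    {ι : Type*} (s : Finset ι) (f : ι → ℤ[X]) (z : ι → Fin n → ℤ)
    (h : ∀ c ∈ s, ofInt ha (z c) ∈ I) :
    ofInt ha (fun i => ∑ c ∈ s, (f c).eval (a i) * z c i) ∈ I := by
  have : ofInt ha (fun i => ∑ c ∈ s, (f c).eval (a i) * z c i) =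
      ∑ c ∈ s, AdjoinRoot.mk (chi a) (f c) • ofInt ha (z c) :=
    (eq_ofInt fun i => by simp [coords_smul, coords_ofInt]).symm
  rw [this]
  exact Submodule.sum_mem _ fun c hc => I.smul_mem _ (h c hc)

theorem exists_eval_eq_of_mul_eq_one (ha : Function.Injective a)
    {I J : Submodule (ring a) (RatAlg (ring a))} (hIJ : I * J = 1) {z w : Fin n → ℤ}
    (hz : ofInt ha z ∈ I) (hw : ofInt ha w ∈ J) : ∃ f : ℤ[X], ∀ i, z i * w i = f.eval (a i) := by
  have h := Submodule.mul_mem_mul hz hw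
  rw [hIJ, ← ofInt_mul, mem_one_iff_coords ha] at h
  obtain ⟨f, hf⟩ := h
  refine ⟨f, fun i => ?_⟩
  have := hf i
  rw [coords_ofInt] at this
  exact_mod_cast this

section
variable (ha : Function.Injective a) {I J : Submodule (ring a) (RatAlg (ring a))}
  (hIJ : I * J = 1) (hI : ∀ x ∈ I, ∃ z, x = ofInt ha z) (hJ : ∀ x ∈ J, ∃ z, x = ofInt ha z)
include hIJ hI hJ

/-- Polynomial values agree modulo p on a residue class. If every element of `I` vanished modulo p
somewhere on the class, all products in `I * J` would vanish on the whole class, contradicting 1 ∈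
`I * J`. -/
theorem exists_ne_zero_mod_on_class (p : ℕ) [hp : Fact p.Prime] (c : ZMod p) :
    ∃ z, ofInt ha z ∈ I ∧ ∀ i, (a i : ZMod p) = c → (z i : ZMod p) ≠ 0 := by
  by_cases hc : ∃ j, (a j : ZMod p) = c
  swap
  · exact ⟨0, by simp [ofInt_zero],
      fun i hi => absurd ⟨i, hi⟩ hc⟩
  obtain ⟨j, rfl⟩ := hc
  by_contra! hcon
  have key : ∀ x ∈ I * J, ∃ d : ℤ, coords ha x j = (p * d : ℤ) := by
    intro x hx
    induction hx using Submodule.mul_induction_on' with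
    | mem_mul_mem x hx y hy =>
      obtain ⟨z, rfl⟩ := hI x hx
      obtain ⟨w, rfl⟩ := hJ y hy
      obtain ⟨f, hf⟩ := exists_eval_eq_of_mul_eq_one ha hIJ hx hy
      obtain ⟨i, hi, hzi⟩ := hcon z hx
      have h1 : ((f.eval (a i) : ℤ) : ZMod p) = 0 := by rw [← hf, Int.cast_mul, hzi, zero_mul]
      have h2 : ((f.eval (a j) : ℤ) : ZMod p) = 0 := by
        rw [← h1, ← eq_intCast (Int.castRingHom (ZMod p)), ← eq_intCast (Int.castRingHom (ZMod p)),
          ← eval₂_at_apply, ← eval₂_at_apply]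
        simp [hi]
      obtain ⟨d, hd⟩ := (ZMod.intCast_zmod_eq_zero_iff_dvd _ _).mp h2
      refine ⟨d, ?_⟩
      rw [← ofInt_mul, coords_ofInt, Pi.mul_apply, hf, hd]
    | add x _ y _ hx hy =>
      obtain ⟨d, hd⟩ := hx
      obtain ⟨e, he⟩ := hy
      exact ⟨d + e, by simp [hd, he, mul_add]⟩
  obtain ⟨d, hd⟩ := key 1 (by rw [hIJ]; exact (Submodule.one_le.mp le_rfl))
  rw [map_one, Pi.one_apply] at hd
  have h3 : (p : ℤ) * d = 1 := by exact_mod_cast hd.symm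
  have h4 : (p : ℤ) ∣ 1 := ⟨d, h3.symm⟩
  exact hp.out.one_lt.ne' (by exact_mod_cast Int.eq_one_of_dvd_one (by positivity) h4)

theorem exists_ne_zero_mod (p : ℕ) [hp : Fact p.Prime] :
    ∃ z, ofInt ha z ∈ I ∧ ∀ i, (z i : ZMod p) ≠ 0 := by
  choose z hzI hz using exists_ne_zero_mod_on_class ha hIJ hI hJ p
  -- By Fermat, 1 - (X - c)^(p-1) is the indicator of the class c modulo p, which glues the local
  -- choices.
  refine ⟨_, ofInt_sum_mem ha Finset.univ
    (fun c : ZMod p => 1 - (X - C (c.val : ℤ)) ^ (p - 1)) z fun c _ => hzI c, fun i => ?_⟩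
  have h1 : p - 1 ≠ 0 := by have := hp.out.two_le; omega
  simp only [Int.cast_sum, Int.cast_mul, eval_sub, eval_one, eval_pow, eval_X, eval_C,
    Int.cast_sub, Int.cast_pow, Int.cast_natCast, ZMod.natCast_zmod_val, Int.cast_one]
  rw [Finset.sum_eq_single (a i : ZMod p)]
  · simpa [h1] using hz _ i rfl
  · intro c _ hc
    have : ((a i : ZMod p) - c) ^ (p - 1) = 1 := ZMod.pow_card_sub_one_eq_one
      (sub_ne_zero.mpr hc.symm)
    simp [this]
  · simp

theorem exists_isUnit_mod (m : ℕ) (hm : m ≠ 0) :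
    ∃ z, ofInt ha z ∈ I ∧ ∀ i, IsUnit (z i : ZMod m) := by
  have h : ∀ p : ℕ, ∃ z, ofInt ha z ∈ I ∧ (p.Prime → ∀ i, (z i : ZMod p) ≠ 0) := by
    intro p
    by_cases hp : p.Prime
    · have : Fact p.Prime := ⟨hp⟩
      obtain ⟨z, hz, h⟩ := exists_ne_zero_mod ha hIJ hI hJ p
      exact ⟨z, hz, fun _ => h⟩
    · exact ⟨0, by simp [ofInt_zero],
        fun h => absurd h hp⟩
  choose z hzI hz using h
  -- Gluing over primes: modulo p only the summand of p survives, and its coefficient is prime to p.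
  refine ⟨_, ofInt_sum_mem ha m.primeFactors
    (fun p => C ((∏ q ∈ m.primeFactors.erase p, q : ℕ) : ℤ)) z fun p _ => hzI p, fun i => ?_⟩
  rw [ZMod.coe_int_isUnit_iff_isCoprime, Int.isCoprime_iff_gcd_eq_one]
  by_contra hg
  obtain ⟨p, hp, hpg⟩ := Nat.exists_prime_and_dvd hg
  have : Fact p.Prime := ⟨hp⟩
  have hpm : p ∈ m.primeFactors :=
    Nat.mem_primeFactors.mpr ⟨hp, Int.natCast_dvd_natCast.mp
      ((Int.natCast_dvd_natCast.mpr hpg).trans (Int.gcd_dvd_left _ _)), hm⟩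
  have h1 := (ZMod.intCast_zmod_eq_zero_iff_dvd _ p).mpr
    ((Int.natCast_dvd_natCast.mpr hpg).trans (Int.gcd_dvd_right _ _))
  simp only [Int.cast_sum, Int.cast_mul, eval_C, Int.cast_natCast] at h1
  rw [Finset.sum_eq_single p] at h1
  · rw [mul_eq_zero, or_iff_left (hz p hp i), ZMod.natCast_eq_zero_iff,
      hp.prime.dvd_finsetProd_iff] at h1
    obtain ⟨q, hq, hpq⟩ := h1
    rw [Finset.mem_erase, Nat.mem_primeFactors] at hq
    exact hq.1 ((Nat.prime_dvd_prime_iff_eq hp hq.2.1).mp hpq).symm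
  · intro q hq hqp
    rw [(ZMod.natCast_eq_zero_iff _ _).mpr, zero_mul]
    exact Finset.dvd_prod_of_mem _ (Finset.mem_erase.mpr ⟨hqp.symm, hpm⟩)
  · exact fun h => absurd hpm h

/-- Take z ∈ `I` and w ∈ `J` that are units modulo m. For y ∈ `I` both yw and zw are polynomial
values, so y is z times polynomial values modulo m; thus u = z works. -/
theorem exists_eq_unitIdeal (hone : ∀ i, ∃ z, ofInt ha z ∈ I ∧ z i = 1) :
    ∃ u, I = unitIdeal ha u := by
  obtain ⟨z, hzI, hz⟩ := exists_isUnit_mod ha hIJ hI hJ _ (modulus_ne_zero ha)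
  obtain ⟨w, hwJ, hw⟩ := exists_isUnit_mod ha ((mul_comm J I).trans hIJ) hJ hI _ (modulus_ne_zero ha)
  obtain ⟨f₀, hf₀⟩ := exists_eval_eq_of_mul_eq_one ha hIJ hzI hwJ
  refine ⟨fun i => (hz i).unit, le_antisymm ?_ ?_⟩
  · intro x hx
    obtain ⟨y, rfl⟩ := hI x hx
    obtain ⟨g, hg⟩ := exists_eval_eq_of_mul_eq_one ha hIJ hx hwJ
    obtain ⟨h, hh⟩ := (polyUnits a n).inv_mem (x := fun i => (hz i).unit * (hw i).unit)
      ⟨f₀, fun i _ => by simp [← hf₀]⟩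
    refine ofInt_mem_unitIdeal.mpr ⟨h * g, fun i => ?_⟩
    have h1 := hh i i.2
    rw [Pi.inv_apply, mul_inv_rev, Units.val_mul] at h1
    rw [eval_mul, ← hg, Int.cast_mul, Int.cast_mul, ← h1]
    have h2 : ((hw i).unit⁻¹ : (ZMod (modulus a))ˣ).val * (w i : ZMod (modulus a)) = 1 :=
      (hw i).val_inv_mul
    have h3 : ((hz i).unit⁻¹ : (ZMod (modulus a))ˣ).val * (z i : ZMod (modulus a)) = 1 :=
      (hz i).val_inv_mul
    rw [IsUnit.unit_spec]
    linear_combination (-(y i : ZMod (modulus a)) * (z i : ZMod (modulus a)) *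
      ((hz i).unit⁻¹ : (ZMod (modulus a))ˣ).val) * h2 - (y i : ZMod (modulus a)) * h3
  · rintro x ⟨y, hy, f, hf⟩
    rw [eq_ofInt hy]
    have h2 : ∀ i, ∃ q, y i = f.eval (a i) * z i + modulus a * q := fun i => by
      have : ((y i - f.eval (a i) * z i : ℤ) : ZMod (modulus a)) = 0 := by
        push_cast [hf, IsUnit.unit_spec]
        ring
      obtain ⟨q, hq⟩ := (ZMod.intCast_zmod_eq_zero_iff_dvd _ _).mp this
      exact ⟨q, by rw [← hq]; ring⟩
    choose q hq using h2
    choose X hXI hX using hone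
    -- This gives mℤⁿ ⊆ `I`: the element with i-th coordinate 1 is multiplied by a polynomial
    -- supported at `a i`.
    choose g hg using fun i => exists_interpolation_modulus (a := a) (Pi.single i (q i))
    have h3 := add_mem (ofInt_sum_mem ha {()} (fun _ => f) (fun _ => z) fun _ _ => hzI)
      (ofInt_sum_mem ha Finset.univ g X fun i _ => hXI i)
    rw [← ofInt_add] at h3
    convert h3 using 2
    ext j
    rw [hq]
    simp only [Finset.sum_singleton, Pi.add_apply, hg]
    rw [Finset.sum_eq_single j]
    · simp [hX]
    · intro i _ hij
      simp [hij.symm]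
    · simp
end

theorem exists_generator_of_fg (M : Submodule ℤ ℚ) (hM : M.FG) : ∃ q : ℚ, M = ℤ ∙ q := by
  have h := FractionalIdeal.isPrincipal (K := ℚ)
    (⟨M, FractionalIdeal.isFractional_of_fg hM⟩ : FractionalIdeal (nonZeroDivisors ℤ) ℚ)
  exact h.principal

/-- The i-th coordinate of k is a generator of the i-th projection of `I`, a finitely generated
subgroup of ℚ. -/
theorem exists_scaling (ha : Function.Injective a) {I : Submodule (ring a) (RatAlg (ring a))}
    (hI : IsFracIdeal I) : ∃ k : (RatAlg (ring a))ˣ,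
      (∀ x ∈ I, ∃ z : Fin n → ℤ, x = k * ofInt ha z) ∧
      ∀ i, ∃ z : Fin n → ℤ, (k : RatAlg (ring a)) * ofInt ha z ∈ I ∧ z i = 1 := by
  rw [isFracIdeal_iff] at hI
  let π : Fin n → RatAlg (ring a) →ₗ[ℚ] ℚ := fun i =>
    (LinearMap.proj i).comp (coords ha).toLinearMap
  have hπ : ∀ i x, π i x = coords ha x i := fun i x => rfl
  choose q hq using fun i => exists_generator_of_fg _
    (hI.1.map ((π i).restrictScalars ℤ))
  have hq0 : ∀ i, q i ≠ 0 := by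
    intro i h0
    have h1 : Submodule.span ℚ (I : Set (RatAlg (ring a))) ≤ LinearMap.ker (π i) := by
      rw [Submodule.span_le]
      intro x hx
      have : π i x ∈ (I.restrictScalars ℤ).map ((π i).restrictScalars ℤ) := ⟨x, hx, rfl⟩
      rw [hq, h0, Submodule.mem_span_singleton] at this
      obtain ⟨c, hc⟩ := this
      simpa using hc.symm
    rw [hI.2] at h1
    have h2 : π i 1 = 0 := h1 (Submodule.mem_top (x := 1))
    rw [hπ, map_one] at h2
    exact one_ne_zero h2
  let k : (RatAlg (ring a))ˣ := Units.map (coords ha).symm.toAlgHom.toRingHom.toMonoidHom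
    (MulEquiv.piUnits.symm fun i => Units.mk0 (q i) (hq0 i))
  have hk : ∀ i, coords ha (k : RatAlg (ring a)) i = q i := fun i => by simp [k]
  have hz : ∀ x ∈ I, ∃ z : Fin n → ℤ, x = k * ofInt ha z := by
    intro x hx
    have : ∀ i, ∃ c : ℤ, c • q i = coords ha x i := fun i => by
      rw [← Submodule.mem_span_singleton, ← hq]
      exact ⟨x, hx, rfl⟩
    choose z hz using this
    refine ⟨z, (coords ha).injective ?_⟩
    ext i
    rw [map_mul, Pi.mul_apply, hk, coords_ofInt, ← hz, zsmul_eq_mul, mul_comm]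
  refine ⟨k, hz, fun i => ?_⟩
  have : q i ∈ (I.restrictScalars ℤ).map ((π i).restrictScalars ℤ) := by
    rw [hq]
    exact Submodule.mem_span_singleton_self _
  obtain ⟨x, hx, hxi⟩ := this
  obtain ⟨z, rfl⟩ := hz x hx
  refine ⟨z, hx, ?_⟩
  change coords ha _ i = q i at hxi
  rw [map_mul, Pi.mul_apply, hk, coords_ofInt] at hxi
  exact_mod_cast mul_left_cancel₀ (hq0 i) (hxi.trans (mul_one _).symm)

theorem classHom_surjective (ha : Function.Injective a) : Function.Surjective (classHom ha) := by
  intro c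
  obtain ⟨⟨I, hIf⟩, hIc⟩ := Con.mk'_surjective (c := linearEquiv (ring a)) (c : ICM (ring a))
  obtain ⟨⟨J, hJf⟩, hJc⟩ := Con.mk'_surjective (c := linearEquiv (ring a)) (c⁻¹ : Cl (ring a)).val
  have h1 : (linearEquiv (ring a)).mk' (⟨I, hIf⟩ * ⟨J, hJf⟩) = (linearEquiv (ring a)).mk' 1 := by
    rw [map_mul, hIc, hJc, map_one, Units.mul_inv]
  obtain ⟨l, hl⟩ := (Con.eq _).mp h1
  replace hl : I * J = (l : RatAlg (ring a)) • (1 : Submodule (ring a) (RatAlg (ring a))) := hl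
  obtain ⟨k, hk, hk1⟩ := exists_scaling ha hIf
  have hmem : ∀ x : RatAlg (ring a), x ∈ ((k⁻¹ : (RatAlg (ring a))ˣ) : RatAlg (ring a)) • I ↔
      k * x ∈ I := by
    intro x
    rw [Submodule.mem_smul_pointwise_iff_exists]
    constructor
    · rintro ⟨y, hy, rfl⟩
      simpa using hy
    · exact fun h => ⟨_, h, by simp⟩
  have hprod : (((k⁻¹ : (RatAlg (ring a))ˣ) : RatAlg (ring a)) • I) *
      (((k * l⁻¹ : (RatAlg (ring a))ˣ) : RatAlg (ring a)) • J) = 1 := by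
    simp only [← Submodule.span_singleton_mul] at hl ⊢
    rw [mul_mul_mul_comm, Submodule.span_mul_span, Set.singleton_mul_singleton, hl, ← mul_assoc,
      Submodule.span_mul_span, Set.singleton_mul_singleton, ← Units.val_mul, ← Units.val_mul]
    simp [Submodule.one_eq_span, Submodule.span_mul_span]
  have hIint : ∀ x ∈ ((k⁻¹ : (RatAlg (ring a))ˣ) : RatAlg (ring a)) • I, ∃ z, x = ofInt ha z := by
    intro x hx
    obtain ⟨z, hz⟩ := hk _ ((hmem x).mp hx)
    exact ⟨z, (Units.mul_right_inj k).mp hz⟩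
  have hone : ∀ i, ∃ z, ofInt ha z ∈ ((k⁻¹ : (RatAlg (ring a))ˣ) : RatAlg (ring a)) • I ∧
      z i = 1 := by
    intro i
    obtain ⟨z, hz, hzi⟩ := hk1 i
    exact ⟨z, (hmem _).mpr hz, hzi⟩
  -- Integrality of the inverse is automatic: multiplying by an element of the scaled `I` with i-th
  -- coordinate 1 lands in `R`.
  have hJint : ∀ x ∈ ((k * l⁻¹ : (RatAlg (ring a))ˣ) : RatAlg (ring a)) • J,
      ∃ z, x = ofInt ha z := by
    intro x hx
    have : ∀ i, ∃ d : ℤ, coords ha x i = d := by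
      intro i
      obtain ⟨z, hz, hzi⟩ := hone i
      have h2 := Submodule.mul_mem_mul hz hx
      rw [hprod, mem_one_iff_coords ha] at h2
      obtain ⟨f, hf⟩ := h2
      have h3 := hf i
      rw [map_mul, Pi.mul_apply, coords_ofInt, hzi, Int.cast_one, one_mul] at h3
      exact ⟨_, h3⟩
    choose z hz using this
    exact ⟨z, eq_ofInt hz⟩
  obtain ⟨u, hu⟩ := exists_eq_unitIdeal ha hprod hIint hJint hone
  refine ⟨u, Units.ext ?_⟩
  rw [← hIc]
  refine (Con.eq _).mpr ⟨k⁻¹, ?_⟩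
  exact hu.symm

/-! ### The index of the polynomial tuples. -/

/-- The absolute value of `∏ i < k, (a k - a i)`. -/
def lowerProd (a : Fin n → ℤ) (k : Fin n) : ℕ := (∏ i ∈ Finset.Iio k, (a k - a i)).natAbs

theorem lowerProd_dvd_modulus (a : Fin n → ℤ) (k : Fin n) : lowerProd a k ∣ modulus a := by
  rw [← Int.natCast_dvd_natCast, lowerProd, Int.natAbs_dvd]
  exact (prod_sub_dvd_diffProd k _ (by simp)).trans (diffProd_dvd_modulus a)

theorem lowerProd_ne_zero (ha : Function.Injective a) (k : Fin n) : lowerProd a k ≠ 0 :=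
  ne_zero_of_dvd_ne_zero (modulus_ne_zero ha) (lowerProd_dvd_modulus a k)

/-- Makes `obstruction` independent of the interpolating polynomial. -/
theorem eval_eq_eval_of_eq (ha : Function.Injective a) (k : Fin n) {f g : ℤ[X]}
    (h : ∀ i : Fin n, (i : ℕ) < k →
      ((f.eval (a i) : ℤ) : ZMod (modulus a)) = (g.eval (a i) : ℤ)) :
    ((f.eval (a k) : ℤ) : ZMod (lowerProd a k)) = (g.eval (a k) : ℤ) := by
  have := prod_sub_dvd_eval ha (Finset.Iio k) k (by simp) (f - g) fun i hi => by
    rw [← ZMod.intCast_zmod_eq_zero_iff_dvd]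
    simp [h i (Fin.lt_def.mp (Finset.mem_Iio.mp hi))]
  rw [← sub_eq_zero, ← Int.cast_sub, ZMod.intCast_zmod_eq_zero_iff_dvd, lowerProd, Int.natAbs_dvd]
  simpa using this

/-- Reduction of units modulo `m` to units modulo `∏ i < k, (a k - a i)`. -/
def reduceUnits (a : Fin n → ℤ) (k : Fin n) : (ZMod (modulus a))ˣ →* (ZMod (lowerProd a k))ˣ :=
  ZMod.unitsMap (lowerProd_dvd_modulus a k)

/-- A polynomial having the given values at the first `k` points. -/
noncomputable def polyOf (k : Fin n) (u : polyUnits a k) : ℤ[X] := u.2.choose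

theorem polyOf_spec (k : Fin n) (u : polyUnits a k) (i : Fin n) (hi : (i : ℕ) < k) :
    ((u.1 i : (ZMod (modulus a))ˣ) : ZMod (modulus a)) = ((polyOf k u).eval (a i) : ℤ) :=
  u.2.choose_spec i hi

/-- The obstruction to extending a polynomial tuple of length `k` to one of length `k + 1`. -/
noncomputable def obstruction (ha : Function.Injective a) (k : Fin n) :
    polyUnits a k →* (ZMod (lowerProd a k))ˣ :=
  MonoidHom.toHomUnits
    -- The quotient f(a_k)/u_k; its values are units because the source is a group.
    { toFun := fun u => ((polyOf k u).eval (a k) : ℤ) * (reduceUnits a k (u.1 k)⁻¹).val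
      map_one' := by
        rw [eval_eq_eval_of_eq ha k (g := 1) fun i hi => by
          rw [← polyOf_spec k 1 i hi]; simp]
        simp
      map_mul' := fun u v => by
        rw [eval_eq_eval_of_eq ha k (g := polyOf k u * polyOf k v) fun i hi => by
          rw [← polyOf_spec k _ i hi, eval_mul, Int.cast_mul, ← polyOf_spec k u i hi,
            ← polyOf_spec k v i hi]
          simp]
        simp only [eval_mul, Int.cast_mul, Subgroup.coe_mul, Pi.mul_apply, mul_inv, map_mul,
          Units.val_mul]
        ring }

theorem obstruction_eq_iff (ha : Function.Injective a) (k : Fin n) (u : polyUnits a k)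
    (f : ℤ[X]) (hf : ∀ i : Fin n, (i : ℕ) < k →
      ((u.1 i : (ZMod (modulus a))ˣ) : ZMod (modulus a)) = (f.eval (a i) : ℤ))
    (c : (ZMod (lowerProd a k))ˣ) :
    obstruction ha k u = c ↔
      ((f.eval (a k) : ℤ) : ZMod (lowerProd a k)) = c * (reduceUnits a k (u.1 k)).val := by
  rw [Units.ext_iff]
  change ((polyOf k u).eval (a k) : ℤ) * (reduceUnits a k (u.1 k)⁻¹).val = c.val ↔ _
  rw [eval_eq_eval_of_eq ha k (g := f) fun i hi => by rw [← polyOf_spec k _ i hi, hf i hi],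
    map_inv, Units.mul_inv_eq_iff_eq_mul]

theorem reduceUnits_val {k : Fin n} {u : (ZMod (modulus a))ˣ} {z : ℤ}
    (h : (u : ZMod (modulus a)) = z) : (reduceUnits a k u).val = z := by
  rw [reduceUnits, ZMod.unitsMap_val, h, ZMod.cast_intCast (lowerProd_dvd_modulus a k)]

theorem polyUnits_succ_le (k : ℕ) : polyUnits a (k + 1) ≤ polyUnits a k :=
  fun _ ⟨f, hf⟩ => ⟨f, fun i hi => hf i (by omega)⟩

theorem ker_obstruction (ha : Function.Injective a) (k : Fin n) :
    (obstruction ha k).ker = (polyUnits a (k + 1)).subgroupOf (polyUnits a k) := by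
  ext u
  rw [MonoidHom.mem_ker, Subgroup.mem_subgroupOf]
  constructor
  · intro h
    obtain ⟨f, hf⟩ := u.2
    rw [obstruction_eq_iff ha k u f hf, Units.val_one, one_mul] at h
    obtain ⟨z, hz⟩ := ZMod.intCast_surjective ((u.1 k : (ZMod (modulus a))ˣ) : ZMod (modulus a))
    rw [reduceUnits_val hz.symm, ← sub_eq_zero, ← Int.cast_sub,
      ZMod.intCast_zmod_eq_zero_iff_dvd, lowerProd, Int.natAbs_dvd] at h
    obtain ⟨c, hc⟩ := h
    -- A Newton correction: the added term vanishes at the earlier points and repairs the value at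
    -- `a k`.
    refine ⟨f - C c * ∏ i ∈ Finset.Iio k, (X - C (a i)), fun i hi => ?_⟩
    rcases Nat.lt_succ_iff_lt_or_eq.mp hi with hlt | heq
    · rw [hf i hlt, eval_sub, eval_mul, eval_prod, Finset.prod_eq_zero (Finset.mem_Iio.mpr (Fin.lt_def.mpr hlt))]
      · simp
      · simp
    · obtain rfl : i = k := Fin.ext heq
      rw [← hz]
      congr 1
      simp only [eval_sub, eval_mul, eval_prod, eval_C, eval_X]
      linear_combination -hc
  · rintro ⟨f, hf⟩
    rw [obstruction_eq_iff ha k u f fun i hi => hf i (by omega), Units.val_one, one_mul,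
      reduceUnits_val (hf k (Nat.lt_succ_self _))]

theorem obstruction_surjective (ha : Function.Injective a) (k : Fin n) :
    Function.Surjective (obstruction ha k) := by
  intro c
  have : NeZero (modulus a) := ⟨modulus_ne_zero ha⟩
  obtain ⟨v, hv⟩ := ZMod.unitsMap_surjective (lowerProd_dvd_modulus a k) c
  have hmem : ∀ i : Fin n, (i : ℕ) < k → (((Pi.mulSingle k v⁻¹ : Fin n → (ZMod (modulus a))ˣ) i :
      (ZMod (modulus a))ˣ) : ZMod (modulus a)) = ((1 : ℤ[X]).eval (a i) : ℤ) := by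
    intro i hi
    rw [Pi.mulSingle_eq_of_ne (by rintro rfl; exact lt_irrefl _ hi)]
    simp
  refine ⟨⟨Pi.mulSingle k v⁻¹, 1, hmem⟩, ?_⟩
  -- Only the k-th entry differs from 1, so the constant 1 interpolates and the obstruction is the
  -- inverse of that entry.
  rw [obstruction_eq_iff ha k _ 1 hmem]
  have : reduceUnits a k v = c := hv
  simp [this]

theorem relIndex_polyUnits (ha : Function.Injective a) (k : Fin n) :
    (polyUnits a (k + 1)).relIndex (polyUnits a k) = (lowerProd a k).totient := by
  have : NeZero (lowerProd a k) := ⟨lowerProd_ne_zero ha k⟩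
  rw [Subgroup.relIndex, ← ker_obstruction ha k, Subgroup.index_ker,
    MonoidHom.range_eq_top.mpr (obstruction_surjective ha k), Subgroup.card_top,
    Nat.card_eq_fintype_card, ZMod.card_units_eq_totient]

theorem index_polyUnits (ha : Function.Injective a) :
    (polyUnits a n).index = ∏ k, (lowerProd a k).totient := by
  have h : ∀ j (hj : j ≤ n), (polyUnits a j).index =
      ∏ k : Fin j, (lowerProd a (Fin.castLE hj k)).totient := by
    intro j
    induction j with
    | zero =>
      intro _
      rw [Finset.univ_eq_empty, Finset.prod_empty, Subgroup.index_eq_one, eq_top_iff]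
      exact fun u _ => ⟨0, fun i hi => absurd hi (Nat.not_lt_zero _)⟩
    | succ j ih =>
      intro hj
      rw [← Subgroup.relIndex_mul_index (polyUnits_succ_le j), ih (by omega),
        Fin.prod_univ_castSucc, mul_comm]
      congr 1
      exact relIndex_polyUnits ha ⟨j, hj⟩
  exact h n le_rfl

/-! ### The class number for spread at least four. -/

theorem card_Cl (ha : Function.Injective a) :
    Nat.card (Cl (ring a)) = (signs a ⊔ polyUnits a n).index := by
  rw [← ker_classHom ha, Subgroup.index_ker, MonoidHom.range_eq_top.mpr (classHom_surjective ha),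
    Subgroup.card_top]

theorem neg_one_ne_one_units (ha : Function.Injective a) : (-1 : (ZMod (modulus a))ˣ) ≠ 1 := by
  have : Fact (2 < modulus a) := ⟨by have := four_le_modulus ha; omega⟩
  intro h
  exact ZMod.neg_one_ne_one (congrArg Units.val h)

theorem card_signs (ha : Function.Injective a) : Nat.card (signs a) = 2 ^ n := by
  have h : (signs a : Set (Fin n → (ZMod (modulus a))ˣ)) = Set.univ.pi fun _ => {1, -1} := by
    ext u
    simp [signs]
  have : Nat.card (signs a) = Nat.card (Fin n → ({1, -1} : Set (ZMod (modulus a))ˣ)) := by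
    refine Nat.card_congr ((Equiv.setCongr h).trans (Equiv.Set.univPi _))
  rw [this, Nat.card_fun, Nat.card_coe_set_eq, Set.ncard_pair (neg_one_ne_one_units ha).symm]
  simp

/-- A tuple of signs which is polynomial modulo `m` is the tuple of values of a polynomial. -/
theorem exists_eval_eq_sign {s : Fin n → ℤ} {u : Fin n → (ZMod (modulus a))ˣ}
    (hsu : ∀ i, (s i : ZMod (modulus a)) = u i) (hu : u ∈ polyUnits a n) :
    ∃ f : ℤ[X], ∀ i, f.eval (a i) = s i := by
  obtain ⟨f, hf⟩ := hu
  have h2 : ∀ i, ∃ w, s i = f.eval (a i) + modulus a * w := fun i => by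
    have : ((s i - f.eval (a i) : ℤ) : ZMod (modulus a)) = 0 := by
      rw [Int.cast_sub, hsu, hf i i.2, sub_self]
    obtain ⟨q, hq⟩ := (ZMod.intCast_zmod_eq_zero_iff_dvd _ _).mp this
    exact ⟨q, by rw [← hq]; ring⟩
  choose w hw using h2
  obtain ⟨g, hg⟩ := exists_interpolation_modulus (a := a) w
  exact ⟨f + g, fun i => by rw [hw, eval_add, hg]⟩

/-- Differences of signs have absolute value at most 2. The spread divides the difference at the
endpoints, so that one is 0; then (a_i - a_{i₀})(a_i - a_{i₁}) divides the difference at an interior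
point. -/
theorem sign_values_const (ha : Function.Injective a) {i₀ i₁ : Fin n} (h4 : 4 ≤ a i₁ - a i₀)
    (hlo : ∀ i, a i₀ ≤ a i) (hhi : ∀ i, a i ≤ a i₁) {s : Fin n → ℤ} (hs : s * s = 1) {f : ℤ[X]}
    (hf : ∀ i, f.eval (a i) = s i) (i : Fin n) : s i = s i₀ := by
  have hs' : ∀ i, s i = 1 ∨ s i = -1 := fun i => mul_self_eq_one_iff.mp (congrFun hs i)
  have hends : s i₁ = s i₀ := by
    have h1 := sub_dvd_eval_sub (a i₁) (a i₀) f
    rw [hf, hf] at h1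
    refine sub_eq_zero.mp (Int.eq_zero_of_abs_lt_dvd h1 ?_)
    rcases hs' i₁ with h | h <;> rcases hs' i₀ with h' | h' <;> rw [h, h'] <;> norm_num <;> omega
  by_cases hi₀ : i = i₀
  · rw [hi₀]
  by_cases hi₁ : i = i₁
  · rw [hi₁, hends]
  have h2 : ∏ j ∈ {i₀, i₁}, (X - C (a j)) ∣ f - C (s i₀) := by
    refine prod_X_sub_C_dvd_of_eval_eq_zero ha _ _ fun j hj => ?_
    rcases Finset.mem_insert.mp hj with rfl | hj
    · simp [hf]
    · rw [Finset.mem_singleton.mp hj]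
      simp [hf, hends]
  have hne : i₀ ≠ i₁ := by
    rintro rfl
    omega
  have h3 := eval_dvd (x := a i) h2
  rw [Finset.prod_pair hne] at h3
  simp only [eval_mul, eval_sub, eval_X, eval_C, hf] at h3
  refine sub_eq_zero.mp (Int.eq_zero_of_abs_lt_dvd (neg_dvd.mpr h3) ?_)
  have hl : a i₀ < a i := lt_of_le_of_ne (hlo i) fun h => hi₀ (ha h).symm
  have hh : a i < a i₁ := lt_of_le_of_ne (hhi i) fun h => hi₁ (ha h)
  -- For integers x, y ≥ 1 with x + y ≥ 4, (x - 1)(y - 1) ≥ 0 gives xy ≥ x + y - 1 ≥ 3.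
  have h5 : 3 ≤ -((a i - a i₀) * (a i - a i₁)) := by
    nlinarith [mul_nonneg (show 0 ≤ a i - a i₀ - 1 by omega) (show 0 ≤ a i₁ - a i - 1 by omega)]
  refine lt_of_lt_of_le (b := 3) ?_ h5
  rcases hs' i with h | h <;> rcases hs' i₀ with h' | h' <;> rw [h, h'] <;> norm_num

theorem relIndex_polyUnits_signs (ha : Function.Injective a) {i₀ i₁ : Fin n}
    (h4 : 4 ≤ a i₁ - a i₀) (hlo : ∀ i, a i₀ ≤ a i) (hhi : ∀ i, a i ≤ a i₁) :
    2 * (polyUnits a n).relIndex (signs a) = 2 ^ n := by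
  rw [← card_signs ha, ← Subgroup.card_mul_index ((polyUnits a n).subgroupOf (signs a))]
  congr 1
  have hone : (1 : Fin n → (ZMod (modulus a))ˣ) ∈ signs a := one_mem _
  have hneg : (-1 : Fin n → (ZMod (modulus a))ˣ) ∈ signs a := fun i => Or.inr rfl
  have hset : ((polyUnits a n).subgroupOf (signs a) : Set (signs a)) =
      {⟨1, hone⟩, ⟨-1, hneg⟩} := by
    ext ⟨u, hu⟩
    simp only [SetLike.mem_coe, Subgroup.mem_subgroupOf, Set.mem_insert_iff,
      Set.mem_singleton_iff, Subtype.mk.injEq]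
    constructor
    · intro h
      obtain ⟨s, hs, hsu⟩ := exists_sign_of_mem_signs hu
      obtain ⟨f, hf⟩ := exists_eval_eq_sign hsu h
      have hc := sign_values_const ha h4 hlo hhi hs hf
      rcases mul_self_eq_one_iff.mp (congrFun hs i₀) with h1 | h1
      · left
        ext i
        rw [← hsu, hc, h1]
        simp
      · right
        ext i
        rw [← hsu, hc, h1]
        simp
    · rintro (rfl | rfl)
      · exact one_mem _
      · exact ⟨-1, by simp⟩
  rw [← SetLike.coe_sort_coe, Nat.card_coe_set_eq, hset, Set.ncard_pair]
  intro h
  exact neg_one_ne_one_units ha (congrFun (Subtype.ext_iff.mp h) i₀).symm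

theorem card_Cl_mul (ha : Function.Injective a) {i₀ i₁ : Fin n}
    (h4 : 4 ≤ a i₁ - a i₀) (hlo : ∀ i, a i₀ ≤ a i) (hhi : ∀ i, a i ≤ a i₁) :
    2 ^ n * Nat.card (Cl (ring a)) = 2 * ∏ k, (lowerProd a k).totient := by
  rw [card_Cl ha, ← index_polyUnits ha,
    ← Subgroup.relIndex_mul_index (le_sup_right : polyUnits a n ≤ signs a ⊔ polyUnits a n),
    Subgroup.relIndex_sup_right, ← mul_assoc, relIndex_polyUnits_signs ha h4 hlo hhi]

/-! ### Small spread -/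

/-- The distances from `a k` to earlier points are distinct elements of {1, 2, 3}. -/
theorem lowerProd_dvd_six (ha : StrictMono a) (h : ∀ i j, a i - a j < 4) (k : Fin n) :
    lowerProd a k ∣ 6 := by
  have hinj : Set.InjOn (fun i => a k - a i) (Finset.Iio k) := fun i _ j _ hij =>
    ha.injective (sub_right_injective hij)
  have hsub : (Finset.Iio k).image (fun i => a k - a i) ⊆ Finset.Icc 1 3 := by
    intro x hx
    obtain ⟨i, hi, rfl⟩ := Finset.mem_image.mp hx
    have h1 := ha (Finset.mem_Iio.mp hi)
    have h2 := h k i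
    exact Finset.mem_Icc.mpr ⟨by omega, by omega⟩
  rw [lowerProd, ← Int.natCast_dvd_natCast, Int.natAbs_dvd]
  have := Finset.prod_dvd_prod_of_subset _ _ id hsub
  rw [Finset.prod_image hinj] at this
  exact this

theorem units_eq_one_or_neg_one {N : ℕ} (hN : N ∣ 6) (c : (ZMod N)ˣ) : c = 1 ∨ c = -1 := by
  have : N ∈ Nat.divisors 6 := Nat.mem_divisors.mpr ⟨hN, by norm_num⟩
  have h6 : Nat.divisors 6 = {1, 2, 3, 6} := by decide
  rw [h6] at this
  simp only [Finset.mem_insert, Finset.mem_singleton] at this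
  rcases this with rfl | rfl | rfl | rfl <;> revert c <;> decide

/-- The obstruction is 1 or -1, and flipping the sign of the k-th entry removes it in the second
case. -/
theorem polyUnits_le_sup_succ (ha : StrictMono a) (h : ∀ i j, a i - a j < 4) (k : Fin n) :
    polyUnits a k ≤ signs a ⊔ polyUnits a (k + 1) := by
  intro u hu
  have hker : ∀ v : polyUnits a k, obstruction ha.injective k v = 1 → v.1 ∈ polyUnits a (k + 1) := by
    intro v hv
    rw [← MonoidHom.mem_ker, ker_obstruction] at hv
    exact hv
  rcases units_eq_one_or_neg_one (lowerProd_dvd_six ha h k) (obstruction ha.injective k ⟨u, hu⟩)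
    with h1 | h1
  · exact Subgroup.mem_sup_right (hker _ h1)
  · let ε : Fin n → (ZMod (modulus a))ˣ := Pi.mulSingle k (-1)
    have hε : ε ∈ signs a := fun i => by
      rcases eq_or_ne i k with rfl | hi
      · right
        simp [ε]
      · left
        simp [ε, hi]
    obtain ⟨f, hf⟩ := hu
    have hf' : ∀ i : Fin n, (i : ℕ) < k → (((ε * u) i : (ZMod (modulus a))ˣ) :
        ZMod (modulus a)) = (f.eval (a i) : ℤ) := by
      intro i hi
      rw [← hf i hi]
      have : i ≠ k := by
        rintro rfl
        exact lt_irrefl _ hi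
      simp [ε, this]
    have h2 : ε * u ∈ polyUnits a (k + 1) := by
      refine hker ⟨ε * u, f, hf'⟩ ?_
      rw [obstruction_eq_iff _ k _ f hf] at h1
      rw [obstruction_eq_iff _ k _ f hf', h1]
      have : reduceUnits a k (-1) = -1 := Units.ext (by
        rw [reduceUnits_val (z := -1) (by simp)]
        simp)
      simp [ε, this, -neg_mul]
    have : u = ε⁻¹ * (ε * u) := by simp
    rw [this]
    exact Subgroup.mul_mem_sup (inv_mem hε) h2

theorem signs_sup_polyUnits_eq_top (ha : StrictMono a) (h : ∀ i j, a i - a j < 4) :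
    signs a ⊔ polyUnits a n = ⊤ := by
  have key : ∀ k ≤ n, signs a ⊔ polyUnits a k = ⊤ := by
    intro k
    induction k with
    | zero =>
      intro _
      rw [eq_top_iff]
      exact fun u _ => Subgroup.mem_sup_right ⟨0, fun i hi => absurd hi (Nat.not_lt_zero _)⟩
    | succ k ih =>
      intro hk
      rw [eq_top_iff, ← ih (by omega)]
      exact sup_le le_sup_left (polyUnits_le_sup_succ ha h ⟨k, hk⟩)
  exact key n le_rfl

theorem card_Cl_eq_one (ha : StrictMono a) (h : ∀ i j, a i - a j < 4) :
    Nat.card (Cl (ring a)) = 1 := by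
  rw [card_Cl ha.injective, signs_sup_polyUnits_eq_top ha h, Subgroup.index_top]

/-! ### Comparing totients prime by prime. -/

/-- The number of residue classes modulo `p` met by the `a i`. -/
def numResidues (a : Fin n → ℤ) (p : ℕ) : ℕ := (Finset.univ.image fun i => (a i : ZMod p)).card

theorem dvd_lowerProd_iff {p : ℕ} (hp : p.Prime) (k : Fin n) :
    p ∣ lowerProd a k ↔ ∃ i < k, (a i : ZMod p) = a k := by
  rw [lowerProd, ← Int.natCast_dvd_natCast, Int.dvd_natAbs,
    (Nat.prime_iff_prime_int.mp hp).dvd_finsetProd_iff]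
  simp only [Finset.mem_Iio, ZMod.intCast_eq_intCast_iff_dvd_sub]

/-- The indices counted are the first ones in their residue classes. -/
theorem card_filter_not_dvd_lowerProd {p : ℕ} (hp : p.Prime) :
    (Finset.univ.filter fun k => ¬ p ∣ lowerProd a k).card = numResidues a p := by
  rw [numResidues, ← Finset.card_image_of_injOn (f := fun i => (a i : ZMod p))]
  · congr 1
    refine Finset.Subset.antisymm (Finset.image_subset_image (Finset.subset_univ _)) ?_
    intro c hc
    have hne : (Finset.univ.filter fun i => (a i : ZMod p) = c).Nonempty := by
      obtain ⟨i, -, hi⟩ := Finset.mem_image.mp hc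
      exact ⟨i, by simp [hi]⟩
    have hmem := Finset.min'_mem _ hne
    refine Finset.mem_image.mpr ⟨_, ?_, (Finset.mem_filter.mp hmem).2⟩
    rw [Finset.mem_filter, dvd_lowerProd_iff hp]
    refine ⟨Finset.mem_univ _, ?_⟩
    rintro ⟨i, hi, hic⟩
    refine absurd (Finset.min'_le _ i ?_) (not_le_of_gt hi)
    rw [Finset.mem_filter, hic]
    exact ⟨Finset.mem_univ _, (Finset.mem_filter.mp hmem).2⟩
  · intro i hi j hj hij
    simp only [Finset.coe_filter, Finset.mem_univ, true_and, Set.mem_ofPred_eq,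
      dvd_lowerProd_iff hp] at hi hj
    rcases lt_trichotomy i j with h | h | h
    · exact absurd ⟨i, h, hij⟩ hj
    · exact h
    · exact absurd ⟨j, h, hij.symm⟩ hi

theorem card_filter_dvd_lowerProd {p : ℕ} (hp : p.Prime) :
    (Finset.univ.filter fun k => p ∣ lowerProd a k).card = n - numResidues a p := by
  have h := Finset.card_filter_add_card_filter_not (s := (Finset.univ : Finset (Fin n)))
    (fun k => p ∣ lowerProd a k)
  rw [card_filter_not_dvd_lowerProd hp, Finset.card_univ, Fintype.card_fin] at h
  omega

theorem dvd_partialVandermonde_iff {p : ℕ} (hp : p.Prime) (S : Finset (Fin n)) :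
    (p : ℤ) ∣ partialVandermonde a S ↔ ∃ i ∈ S, ∃ j ∈ S, i < j ∧ (a i : ZMod p) = a j := by
  rw [partialVandermonde, (Nat.prime_iff_prime_int.mp hp).dvd_finsetProd_iff]
  simp only [Finset.mem_filter, Finset.mem_product, Prod.exists,
    ZMod.intCast_eq_intCast_iff_dvd_sub]
  constructor
  · rintro ⟨i, j, ⟨⟨hi, hj⟩, hij⟩, h⟩
    exact ⟨i, hi, j, hj, hij, h⟩
  · rintro ⟨i, hi, j, hj, hij, h⟩
    exact ⟨i, j, ⟨⟨hi, hj⟩, hij⟩, h⟩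

/-- By pigeonhole, l + 1 points in at most l classes collide; with more classes, first
representatives of l + 1 of them do not. -/
theorem dvd_vandermondeGcd_iff {p : ℕ} (hp : p.Prime) (l : ℕ) :
    p ∣ vandermondeGcd a l ↔ numResidues a p ≤ l := by
  rw [vandermondeGcd, Finset.dvd_gcd_iff]
  simp only [Finset.mem_powersetCard_univ, ← Int.natCast_dvd, dvd_partialVandermonde_iff hp]
  constructor
  · intro h
    by_contra! hl
    rw [← card_filter_not_dvd_lowerProd hp] at hl
    obtain ⟨S, hS, hcard⟩ := Finset.exists_subset_card_eq (Nat.succ_le_of_lt hl)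
    obtain ⟨i, -, j, hj, hij, h⟩ := h S hcard
    exact (Finset.mem_filter.mp (hS hj)).2 ((dvd_lowerProd_iff hp j).mpr ⟨i, hij, h⟩)
  · intro h S hS
    obtain ⟨i, hi, j, hj, hne, hij⟩ := Finset.exists_ne_map_eq_of_card_lt_of_maps_to
      (s := S) (t := Finset.univ.image fun i => (a i : ZMod p)) (f := fun i => (a i : ZMod p))
      (by rw [hS]; exact Nat.lt_succ_of_le h)
      (fun i _ => Finset.mem_coe.mpr (Finset.mem_image_of_mem _ (Finset.mem_univ i)))
    rcases lt_or_gt_of_ne hne with hlt | hlt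
    · exact ⟨i, hi, j, hj, hlt, hij⟩
    · exact ⟨j, hj, i, hi, hlt, hij.symm⟩

theorem card_filter_dvd_vandermondeGcd (hn : 0 < n) {p : ℕ} (hp : p.Prime) :
    ((Finset.Icc 1 (n - 1)).filter fun l => p ∣ vandermondeGcd a l).card =
      n - numResidues a p := by
  have hr : 1 ≤ numResidues a p :=
    Finset.card_pos.mpr ⟨_, Finset.mem_image_of_mem _ (Finset.mem_univ (⟨0, hn⟩ : Fin n))⟩
  have : (Finset.Icc 1 (n - 1)).filter (fun l => p ∣ vandermondeGcd a l) =
      Finset.Icc (numResidues a p) (n - 1) := by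
    ext l
    rw [Finset.mem_filter, dvd_vandermondeGcd_iff hp, Finset.mem_Icc, Finset.mem_Icc]
    omega
  rw [this, Nat.card_Icc]
  omega

theorem vandermondeGcd_pred (hn : 0 < n) :
    vandermondeGcd a (n - 1) = ∏ k, lowerProd a k := by
  have h : (Finset.univ : Finset (Fin n)).powersetCard (n - 1 + 1) = {Finset.univ} := by
    have := Finset.powersetCard_self (Finset.univ : Finset (Fin n))
    rw [Nat.sub_add_cancel hn]
    rwa [Finset.card_univ, Fintype.card_fin] at this
  rw [vandermondeGcd, h, Finset.gcd_singleton, normalize_eq, partialVandermonde,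
    -- Pairs are grouped by their larger index.
    Finset.prod_filter, Finset.prod_product_right]
  refine (map_prod Int.natAbsHom _ _).trans ?_
  refine Finset.prod_congr rfl fun k _ => ?_
  rw [lowerProd, ← Finset.prod_filter, Finset.filter_gt_eq_Iio]
  rfl

theorem vandermondeGcd_ne_zero (ha : Function.Injective a) {l : ℕ} (hl : l < n) :
    vandermondeGcd a l ≠ 0 := by
  intro h
  rw [vandermondeGcd, Finset.gcd_eq_zero_iff] at h
  obtain ⟨S, -, hS⟩ := Finset.exists_subset_card_eq (s := (Finset.univ : Finset (Fin n)))
    (n := l + 1) (by rwa [Finset.card_univ, Fintype.card_fin])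
  have h0 := h S (Finset.mem_powersetCard_univ.mpr hS)
  rw [Int.natAbs_eq_zero, partialVandermonde, Finset.prod_eq_zero_iff] at h0
  obtain ⟨p, hp, hp0⟩ := h0
  exact (Finset.mem_filter.mp hp).2.ne' (ha (sub_eq_zero.mp hp0))

/-- A common prime set `P` lets the products over primes and over indices be interchanged. -/
theorem totient_div_eq_prod {N : ℕ} (hN : N ≠ 0) {P : Finset ℕ} (hP : N.primeFactors ⊆ P)
    (hprime : ∀ p ∈ P, p.Prime) :
    (N.totient : ℚ) / N = ∏ p ∈ P, if p ∣ N then 1 - (p : ℚ)⁻¹ else 1 := by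
  rw [Nat.totient_eq_mul_prod_factors, mul_div_cancel_left₀ _ (by exact_mod_cast hN),
    ← Finset.prod_filter]
  refine Finset.prod_congr ?_ fun _ _ => rfl
  ext p
  rw [Finset.mem_filter]
  exact ⟨fun h => ⟨hP h, Nat.dvd_of_mem_primeFactors h⟩,
    fun h => Nat.mem_primeFactors.mpr ⟨hprime p h.1, h.2, hN⟩⟩

/-- Both sides contain 1 - 1/p to the power n minus the number of residue classes. -/
theorem prod_totient_lowerProd (ha : Function.Injective a) (hn : 0 < n) :
    ∏ k, ((lowerProd a k).totient : ℚ) / lowerProd a k =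
      ∏ l ∈ Finset.Icc 1 (n - 1), ((vandermondeGcd a l).totient : ℚ) / vandermondeGcd a l := by
  have hV := vandermondeGcd_ne_zero ha (Nat.sub_lt hn Nat.one_pos)
  have hprime : ∀ p ∈ (vandermondeGcd a (n - 1)).primeFactors, p.Prime :=
    fun p hp => Nat.prime_of_mem_primeFactors hp
  have h1 : ∀ k, (lowerProd a k).primeFactors ⊆ (vandermondeGcd a (n - 1)).primeFactors :=
    fun k => Nat.primeFactors_mono
      (by rw [vandermondeGcd_pred hn]; exact Finset.dvd_prod_of_mem _ (Finset.mem_univ k)) hV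
  have h2 : ∀ l ∈ Finset.Icc 1 (n - 1),
      (vandermondeGcd a l).primeFactors ⊆ (vandermondeGcd a (n - 1)).primeFactors := by
    intro l hl p hp
    have hpp := Nat.prime_of_mem_primeFactors hp
    have h3 := (dvd_vandermondeGcd_iff hpp l).mp (Nat.dvd_of_mem_primeFactors hp)
    exact Nat.mem_primeFactors.mpr ⟨hpp, (dvd_vandermondeGcd_iff hpp _).mpr
      (h3.trans (Finset.mem_Icc.mp hl).2), hV⟩
  rw [Finset.prod_congr rfl fun k _ => totient_div_eq_prod (lowerProd_ne_zero ha k) (h1 k) hprime,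
    Finset.prod_congr rfl fun l hl => totient_div_eq_prod (vandermondeGcd_ne_zero ha
      (by have := (Finset.mem_Icc.mp hl).2; omega)) (h2 l hl) hprime,
    Finset.prod_comm, Finset.prod_comm (s := Finset.Icc 1 (n - 1))]
  refine Finset.prod_congr rfl fun p hp => ?_
  rw [← Finset.prod_filter, ← Finset.prod_filter, Finset.prod_const, Finset.prod_const,
    card_filter_dvd_lowerProd (hprime p hp), card_filter_dvd_vandermondeGcd hn (hprime p hp)]

theorem prod_totient_lowerProd_eq (ha : Function.Injective a) (hn : 2 ≤ n) :
    ∏ k, ((lowerProd a k).totient : ℚ) = (vandermondeGcd a (n - 1)).totient *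
      ∏ l ∈ Finset.Icc 1 (n - 2), ((vandermondeGcd a l).totient : ℚ) / vandermondeGcd a l := by
  have h := prod_totient_lowerProd ha (by omega)
  have hV : (vandermondeGcd a (n - 1) : ℚ) ≠ 0 := by
    exact_mod_cast vandermondeGcd_ne_zero ha (show n - 1 < n by omega)
  rw [Finset.prod_div_distrib, ← Nat.cast_prod (fun k => lowerProd a k),
    ← vandermondeGcd_pred (by omega), show n - 1 = n - 2 + 1 by omega,
    Finset.prod_Icc_succ_top (by omega), ← show n - 1 = n - 2 + 1 by omega,
    div_eq_iff hV, mul_assoc, div_mul_cancel₀ _ hV, mul_comm] at h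
  exact h

end TotallyDegenerate

theorem theorem1p1 (n : ℕ) (hn : 0 < n) (a : Fin n → ℤ) (ha : StrictMono a) :
    (4 ≤ a ⟨n - 1, Nat.sub_lt hn Nat.one_pos⟩ - a ⟨0, hn⟩ →
      (Nat.card (TotallyDegenerate.Cl (TotallyDegenerate.ring a)) : ℚ) =
        (Nat.totient (TotallyDegenerate.vandermondeGcd a (n - 1)) : ℚ) / 2 ^ (n - 1) *
          ∏ l ∈ Finset.Icc 1 (n - 2),
            (Nat.totient (TotallyDegenerate.vandermondeGcd a l) : ℚ) /
              (TotallyDegenerate.vandermondeGcd a l : ℚ)) ∧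
    (a ⟨n - 1, Nat.sub_lt hn Nat.one_pos⟩ - a ⟨0, hn⟩ < 4 →
      Nat.card (TotallyDegenerate.Cl (TotallyDegenerate.ring a)) = 1) := by
  have hlo : ∀ i, a ⟨0, hn⟩ ≤ a i := fun i => ha.monotone (Fin.le_def.mpr (Nat.zero_le _))
  have hhi : ∀ i, a i ≤ a ⟨n - 1, Nat.sub_lt hn Nat.one_pos⟩ := fun i =>
    ha.monotone (Fin.le_def.mpr (Nat.le_pred_of_lt i.2))
  constructor
  · intro h4
    -- For n = 1 the spread is 0. From n = 2 on, l = n - 1 lies in `Finset.Icc 1 (n - 1)` and can be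
    -- split off.
    have h2 : 2 ≤ n := by
      by_contra hlt
      obtain rfl : n = 1 := by omega
      simp at h4
    have h := TotallyDegenerate.card_Cl_mul ha.injective h4 hlo hhi
    have h' : (2 ^ n : ℚ) * Nat.card (TotallyDegenerate.Cl (TotallyDegenerate.ring a)) =
        2 * ∏ k, ((TotallyDegenerate.lowerProd a k).totient : ℚ) := by
      exact_mod_cast h
    rw [TotallyDegenerate.prod_totient_lowerProd_eq ha.injective h2] at h'
    obtain ⟨k, rfl⟩ : ∃ k, n = k + 1 := ⟨n - 1, by omega⟩
    rw [div_mul_eq_mul_div, eq_div_iff (by positivity)]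
    rw [pow_succ] at h'
    rw [Nat.add_sub_cancel] at h' ⊢
    linear_combination h' / 2
  · intro h
    refine TotallyDegenerate.card_Cl_eq_one ha fun i j => ?_
    have h1 := hlo j
    have h2 := hhi i
    omega
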